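/- Let $m\ge 1$ be an integer and $F=\mathbb{F}_{2^m}$ the finite field with $2^m$ elements. For $a\in F$ put $$K(a)=\sum_{x\in F\setminus\{0\}}(-1)^{\mathrm{Tr}(ax+1/x)}\in\mathbb{Z},$$ where $\mathrm{Tr}$ is the trace function of $F$ over $\mathbb{F}_2$. Let $b\in F$ and let $n=p/q$ be a rational number in lowest terms, $q>0$, such that $b^n$ is an element of $F$. Here $b^n\in F$ denotes an element $y\in F$ with $y^q=b^p$ (any one of them, if there are several; if $b=0$ it is required that $n\ge 0$), and, for this choice of $b^n$, $b^{n+1}=b^n\cdot b$ and $b^{4n}=(b^n)^4$. If $b^{4n}+1\neq 0$, then $$K\biggl(\frac{(b^{n+1}+b^2)(b^{n+1}+b^n+b^2+1)^3}{b^{4n}+1}\biggr)=K\biggl(\frac{(b^{n+1}+b^2)^3(b^{n+1}+b^n+b^2+1)}{b^{4n}+1}\biggr).$$ -/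

import Mathlib

/-- The Kloosterman sum `K(a) = ∑_{x ∈ F, x ≠ 0} (-1)^{Tr(a x + 1/x)}` over a finite field `F` of
characteristic two, where `Tr` is the trace of `F` over `𝔽₂`; the value is an integer.
The same formula is used for `a = 0`. -/
noncomputable def kloostermanSum {F : Type*} [Field F] [Fintype F] [Algebra (ZMod 2) F]
    (a : F) : ℤ :=
  open Classical in
  ∑ x ∈ Finset.univ.filter (fun x : F => x ≠ 0),
    (-1 : ℤ) ^ (Algebra.trace (ZMod 2) F (a * x + 1 / x)).val

/-- `IsRatPow b n y` says that `y ∈ F` is a value of the rational power `b ^ n`: for `n = p / q` in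
lowest terms with `q > 0`, that `y ^ q = b ^ p`. For negative `n` the base has to be nonzero. -/
def IsRatPow {F : Type*} [Field F] (b : F) (n : ℚ) (y : F) : Prop :=
  (b = 0 → 0 ≤ n) ∧ y ^ n.den = b ^ n.num

/-- If `y` is a value of `b ^ n`, then `y * b` is a value of `b ^ (n + 1)`. -/
theorem IsRatPow.mul_self {F : Type*} [Field F] {b : F} {n : ℚ} {y : F} (h : IsRatPow b n y) :
    IsRatPow b (n + 1) (y * b) := by
  obtain ⟨h0, h⟩ := h
  have hd : (n + 1).den = n.den := by simp
  have hn : (n + 1).num = n.num + n.den := by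
    have h1 : ((n + 1).num : ℚ) = (n + 1) * n.den := by
      rw [← Rat.mul_den_eq_num, hd]
    have h2 : (n.num : ℚ) = n * n.den := (Rat.mul_den_eq_num n).symm
    have h3 : ((n + 1).num : ℚ) = ((n.num + n.den : ℤ) : ℚ) := by
      push_cast
      rw [h1, h2]
      ring
    exact_mod_cast h3
  refine ⟨fun hb => by linarith [h0 hb], ?_⟩
  rw [hd, hn, mul_pow, h]
  by_cases hb : b = 0
  · have h1 : 0 ≤ n.num := Rat.num_nonneg.2 (h0 hb)
    have h2 := n.den_pos
    rw [hb, zero_pow h2.ne', mul_zero, zero_zpow _ (by omega)]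
  · rw [zpow_add₀ hb, zpow_natCast]

/-- If `y` is a value of `b ^ n`, then `y ^ 4` is a value of `b ^ (4 * n)`. -/
theorem IsRatPow.pow_four {F : Type*} [Field F] {b : F} {n : ℚ} {y : F} (h : IsRatPow b n y) :
    IsRatPow b (4 * n) (y ^ 4) := by
  obtain ⟨h0, h⟩ := h
  refine ⟨fun hb => by linarith [h0 hb], ?_⟩
  have e : (4 * n).num * (n.den : ℤ) = 4 * n.num * ((4 * n).den : ℤ) := by
    have h1 : ((4 * n).num : ℚ) = (4 * n) * (4 * n).den := (Rat.mul_den_eq_num _).symm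
    have h2 : (n.num : ℚ) = n * n.den := (Rat.mul_den_eq_num n).symm
    have h3 : ((4 * n).num : ℚ) * n.den = 4 * n.num * (4 * n).den := by
      rw [h1, h2]
      ring
    exact_mod_cast h3
  have hc : IsCoprime (n.den : ℤ) n.num := by
    rw [Int.isCoprime_iff_gcd_eq_one, Int.gcd_comm]
    exact n.reduced
  have hdvd : (n.den : ℤ) ∣ ((4 * (4 * n).den : ℕ) : ℤ) := by
    refine hc.dvd_of_dvd_mul_left (?_ : _ ∣ n.num * _)
    refine ⟨(4 * n).num, ?_⟩
    push_cast
    linarith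
  obtain ⟨k, hk⟩ := Int.natCast_dvd_natCast.1 hdvd
  have hnum : (4 * n).num = n.num * k := by
    have hd0 : (n.den : ℤ) ≠ 0 := by exact_mod_cast n.den_pos.ne'
    have hk' : 4 * ((4 * n).den : ℤ) = n.den * k := by exact_mod_cast hk
    apply mul_right_cancel₀ hd0
    linear_combination e + n.num * hk'
  rw [← pow_mul, hk, pow_mul, h, hnum, zpow_mul, zpow_natCast]

/-! Write χ for `traceSign`, A(s) = χ(s)K(s³(s+1)) and B(s) = χ(s)K(s(s+1)³). The theorem is A(s) =
B(s) at s = (b^{n+1}+b²)/(b^n+1). Both are sums of χ along the x-lines of two curves, elliptic for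
general s, joined by a 3-isogeny with kernel generated by (0,0). This kernel is not rational on the
quadratic twist, so the isogeny is injective on the x with χ = -1, whence B(s) ≤ A(s)
(`traceSign_mul_kloostermanSum_le`). Summed over all s, both sides vanish: A by
`sum_traceSign_mul_kloostermanSum`, B because s ↦ s+1 exchanges the two arguments. Hence every
inequality is an equality. -/

section TraceCharacter

variable {F : Type*} [Field F] [Algebra (ZMod 2) F]

/-- The canonical additive character `(-1) ^ Tr x` of a finite field of characteristic two. -/
noncomputable def traceSign (x : F) : ℤ := (-1 : ℤ) ^ (Algebra.trace (ZMod 2) F x).val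

theorem traceSign_add (x y : F) : traceSign (x + y) = traceSign x * traceSign y := by
  unfold traceSign
  rw [map_add]
  generalize Algebra.trace (ZMod 2) F x = a
  generalize Algebra.trace (ZMod 2) F y = b
  revert a b
  decide

theorem traceSign_zero : traceSign (0 : F) = 1 := by
  simp [traceSign]

theorem traceSign_eq_one_or (x : F) : traceSign x = 1 ∨ traceSign x = -1 :=
  neg_one_pow_eq_or ℤ _

theorem traceSign_mul_self (x : F) : traceSign x * traceSign x = 1 := by
  rcases traceSign_eq_one_or x with h | h <;> simp [h]

variable [Fintype F]

theorem traceSign_sq (x : F) : traceSign (x ^ 2) = traceSign x := by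
  have h := Algebra.trace_eq_of_algEquiv (FiniteField.frobeniusAlgEquivOfAlgebraic (ZMod 2) F) x
  simp only [FiniteField.coe_frobeniusAlgEquivOfAlgebraic, ZMod.card] at h
  rw [traceSign, traceSign, h]

theorem traceSign_sq_add_self (x : F) : traceSign (x ^ 2 + x) = 1 := by
  rw [traceSign_add, traceSign_sq, traceSign_mul_self]

theorem sum_traceSign : ∑ x : F, traceSign x = 0 := by
  obtain ⟨t, ht⟩ := Algebra.trace_surjective (ZMod 2) F 1
  have h1 : traceSign t = -1 := by
    rw [traceSign, ht]; rfl
  have h2 : ∑ x : F, traceSign (x + t) = ∑ x : F, traceSign x :=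
    Equiv.sum_comp (Equiv.addRight t) (traceSign (F := F))
  simp only [traceSign_add, h1, ← Finset.sum_mul] at h2
  linarith

end TraceCharacter

/-! ### Kloosterman sums, a 3-isogeny and averaging over the parameter -/

section Kloosterman

variable {F : Type*} [Field F] [Fintype F] [Algebra (ZMod 2) F]

open Classical in
/-- The Kloosterman sum at `u ^ 2 + v`, with the square absorbed by Frobenius invariance. -/
theorem kloostermanSum_sq_add (u v : F) :
    kloostermanSum (u ^ 2 + v) = ∑ z ∈ Finset.univ.filter (fun z : F => z ≠ 0),
      traceSign (z + u / z + v / z ^ 2) := by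
  unfold kloostermanSum
  symm
  have : CharP F 2 := charP_of_injective_algebraMap (algebraMap (ZMod 2) F).injective 2
  -- Substituting x = z⁻² turns 1/x and u²x into squares, whose roots z and u/z have the same trace.
  refine Finset.sum_bij (fun z _ => (z ^ 2)⁻¹) ?_ ?_ ?_ ?_
  · intro z hz
    simpa using hz
  · intro z _ z' _ h
    exact frobenius_inj F 2 (inv_injective h)
  · intro x hx
    obtain ⟨z, hz⟩ := (frobeniusEquiv F 2).surjective x⁻¹
    have hz' : z ^ 2 = x⁻¹ := hz
    refine ⟨z, ?_, by rw [hz', inv_inv]⟩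
    simp only [Finset.mem_filter, Finset.mem_univ, true_and] at hx ⊢
    rintro rfl
    simp at hz'
    exact hx hz'.symm
  · intro z hz
    simp only [Finset.mem_filter, Finset.mem_univ, true_and] at hz
    change _ = traceSign _
    have e : (u ^ 2 + v) * (z ^ 2)⁻¹ + 1 / (z ^ 2)⁻¹ = z ^ 2 + (u / z) ^ 2 + v / z ^ 2 := by
      field_simp
      ring
    rw [e]
    simp only [traceSign_add, traceSign_sq]

open Classical in
theorem sum_filter_ne_shift {F : Type*} [Field F] [Fintype F] (s : F) (φ : F → ℤ) :
    ∑ z ∈ Finset.univ.filter (fun z : F => z ≠ 0), φ z =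
      ∑ x ∈ Finset.univ.filter (fun x : F => x ≠ s), φ (x - s) := by
  symm
  refine Finset.sum_bij (fun x _ => x - s) ?_ ?_ ?_ ?_
  · intro x hx
    simpa [sub_eq_zero] using hx
  · intro x _ y _ h
    exact sub_left_injective h
  · intro z hz
    exact ⟨z + s, by simpa using hz, by simp⟩
  · intros
    rfl

open Classical in
/-- `K(s³(s+1))` counts points on `y² + xy + sy = x³`. -/
theorem traceSign_mul_kloostermanSum (s : F) :
    traceSign s * kloostermanSum (s ^ 3 * (s + 1)) =
      ∑ x ∈ Finset.univ.filter (fun x : F => x ≠ s), traceSign (x ^ 3 / (x + s) ^ 2) := by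
  have : CharP F 2 := charP_of_injective_algebraMap (algebraMap (ZMod 2) F).injective 2
  -- With this splitting and z = x + s, the numerator of s + z + u/z + v/z² collapses to x³.
  have e : s ^ 3 * (s + 1) = (s ^ 2) ^ 2 + s ^ 3 := by ring
  rw [e, kloostermanSum_sq_add, Finset.mul_sum, sum_filter_ne_shift s]
  refine Finset.sum_congr rfl fun x hx => ?_
  have hx' : x + s ≠ 0 := by
    rw [← CharTwo.sub_eq_add, sub_ne_zero]
    simpa using hx
  rw [← traceSign_add, CharTwo.sub_eq_add]
  congr 1
  field_simp
  linear_combination (2 * s ^ 3 + 2 * s * x ^ 2 + 3 * s ^ 2 * x) * CharTwo.two_eq_zero (R := F)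

open Classical in
/-- `K(s(s+1)³)` counts points on the `3`-isogenous curve `y² + xy + sy = x³ + sx + s² + s`. -/
theorem traceSign_mul_kloostermanSum_isogenous (s : F) :
    traceSign s * kloostermanSum (s * (s + 1) ^ 3) =
      ∑ x ∈ Finset.univ.filter (fun x : F => x ≠ s),
        traceSign ((x ^ 3 + s * x + s ^ 2 + s) / (x + s) ^ 2) := by
  have : CharP F 2 := charP_of_injective_algebraMap (algebraMap (ZMod 2) F).injective 2
  have e : s * (s + 1) ^ 3 = (s ^ 2 + s) ^ 2 + (s ^ 3 + s) := by
    linear_combination s ^ 2 * CharTwo.two_eq_zero (R := F)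
  rw [e, kloostermanSum_sq_add, Finset.mul_sum, sum_filter_ne_shift s]
  refine Finset.sum_congr rfl fun x hx => ?_
  have hx' : x + s ≠ 0 := by
    rw [← CharTwo.sub_eq_add, sub_ne_zero]
    simpa using hx
  rw [← traceSign_add, CharTwo.sub_eq_add]
  congr 1
  field_simp
  linear_combination (2 * s ^ 3 + 2 * s * x ^ 2 + 3 * s ^ 2 * x) * CharTwo.two_eq_zero (R := F)

/-- The `x`-coordinate of the `3`-isogeny with kernel generated by `(0, 0)` respects the quadratic
covers of the `x`-lines by the two curves. -/
theorem traceSign_isogeny {s x : F} (hx : x ≠ 0) (hxs : x + s ≠ 0) (hx2 : x ^ 2 + s ≠ 0) :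
    traceSign (((x + s / x + s ^ 2 / x ^ 2) ^ 3 + s * (x + s / x + s ^ 2 / x ^ 2) + s ^ 2 + s) /
      (x + s / x + s ^ 2 / x ^ 2 + s) ^ 2) = traceSign (x ^ 3 / (x + s) ^ 2) := by
  have : CharP F 2 := charP_of_injective_algebraMap (algebraMap (ZMod 2) F).injective 2
  have h2 := CharTwo.two_eq_zero (R := F)
  -- The two Artin–Schreier arguments differ by w² + w, on which χ is 1.
  set w : F := s * (x + s) / (x * (x ^ 2 + s)) with hw
  have e1 : x + s / x + s ^ 2 / x ^ 2 + s = (x + s) * (x ^ 2 + s) / x ^ 2 := by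
    field_simp
    ring
  have e : ((x + s / x + s ^ 2 / x ^ 2) ^ 3 + s * (x + s / x + s ^ 2 / x ^ 2) + s ^ 2 + s) /
      (x + s / x + s ^ 2 / x ^ 2 + s) ^ 2 = x ^ 3 / (x + s) ^ 2 + (w ^ 2 + w) := by
    rw [e1, hw]
    field_simp
    linear_combination (-(x * s ^ 5) - 3 * x ^ 2 * s ^ 4 - 3 * x ^ 3 * s ^ 3 + x ^ 3 * s ^ 4 -
      x ^ 4 * s ^ 2 + 2 * x ^ 4 * s ^ 3 + 2 * x ^ 6 * s ^ 2 + x ^ 7 * s) * h2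
  rw [e, traceSign_add, traceSign_sq_add_self, mul_one]

/-- Distinct points with the same image under the isogeny differ by a rational kernel point. -/
theorem traceSign_eq_one_of_isogeny_eq {s x y : F} (hs : s ≠ 0) (hx : x ≠ 0) (hy : y ≠ 0)
    (hxs : x + s ≠ 0) (hxy : x ≠ y)
    (h : x + s / x + s ^ 2 / x ^ 2 = y + s / y + s ^ 2 / y ^ 2) :
    traceSign (x ^ 3 / (x + s) ^ 2) = 1 := by
  have : CharP F 2 := charP_of_injective_algebraMap (algebraMap (ZMod 2) F).injective 2
  have h2 := CharTwo.two_eq_zero (R := F)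
  have hq : x ^ 2 * y ^ 2 + s * x * y + s ^ 2 * (x + y) = 0 := by
    field_simp at h
    apply mul_left_cancel₀ (sub_ne_zero.2 hxy)
    linear_combination h + (x - y) * (s * x * y + s ^ 2 * (x + y)) * h2
  -- The line joining (0,0) to a curve point (x, Y) meets the curve again at abscissa sY/x².
  -- Equating this with y gives Y = x²y/s, and Y/(x+s) is the Artin–Schreier root.
  have e : x ^ 3 / (x + s) ^ 2 =
      (x ^ 2 * y / (s * (x + s))) ^ 2 + x ^ 2 * y / (s * (x + s)) := by
    field_simp
    linear_combination (-1 : F) * hq + s ^ 2 * x * h2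
  rw [e, traceSign_sq_add_self]

open Classical in
theorem sum_traceSign_le_of_card_le (s : F) (φ ψ : F → F)
    (h : (Finset.univ.filter fun x : F => x ≠ s ∧ traceSign (φ x) = -1).card ≤
      (Finset.univ.filter fun x : F => x ≠ s ∧ traceSign (ψ x) = -1).card) :
    ∑ x ∈ Finset.univ.filter (fun x : F => x ≠ s), traceSign (ψ x) ≤
      ∑ x ∈ Finset.univ.filter (fun x : F => x ≠ s), traceSign (φ x) := by
  have key (θ : F → F) : ∑ x ∈ Finset.univ.filter (fun x : F => x ≠ s), traceSign (θ x) =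
      (Finset.univ.filter (fun x : F => x ≠ s)).card -
        2 * ((Finset.univ.filter fun x : F => x ≠ s ∧ traceSign (θ x) = -1).card : ℤ) := by
    rw [← Finset.filter_filter, Finset.card_filter (fun x => traceSign (θ x) = -1),
      Finset.card_eq_sum_ones]
    push_cast
    rw [Finset.mul_sum, ← Finset.sum_sub_distrib]
    refine Finset.sum_congr rfl fun x _ => ?_
    rcases traceSign_eq_one_or (θ x) with h | h <;> simp [h]
  rw [key, key]
  have : ((Finset.univ.filter fun x : F => x ≠ s ∧ traceSign (φ x) = -1).card : ℤ) ≤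
      (Finset.univ.filter fun x : F => x ≠ s ∧ traceSign (ψ x) = -1).card := by exact_mod_cast h
  linarith

/-- The isogeny is injective on the rational points of the quadratic twist. -/
theorem traceSign_mul_kloostermanSum_le (s : F) :
    traceSign s * kloostermanSum (s * (s + 1) ^ 3) ≤
      traceSign s * kloostermanSum (s ^ 3 * (s + 1)) := by
  classical
  have : CharP F 2 := charP_of_injective_algebraMap (algebraMap (ZMod 2) F).injective 2
  have h2 := CharTwo.two_eq_zero (R := F)
  rcases eq_or_ne s 0 with rfl | hs
  · simp
  rw [traceSign_mul_kloostermanSum, traceSign_mul_kloostermanSum_isogenous]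
  apply sum_traceSign_le_of_card_le
  -- The map has its pole at x = 0 and takes the excluded value s where x = s or x² = s.
  have good {x : F} (hx : x ≠ s ∧ traceSign (x ^ 3 / (x + s) ^ 2) = -1) :
      x ≠ 0 ∧ x + s ≠ 0 ∧ x ^ 2 + s ≠ 0 := by
    have hxs : x + s ≠ 0 := by
      rw [← CharTwo.sub_eq_add, sub_ne_zero]
      exact hx.1
    have hx0 : x ≠ 0 := by
      rintro rfl
      have := hx.2
      simp [traceSign_zero] at this
    refine ⟨hx0, hxs, fun h => ?_⟩
    have e : s = x ^ 2 := by linear_combination h - x ^ 2 * h2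
    subst e
    have hx1 : 1 + x ≠ 0 := by
      intro h
      apply hxs
      linear_combination x * h
    have e : x ^ 3 / (x + x ^ 2) ^ 2 = (1 / (1 + x)) ^ 2 + 1 / (1 + x) := by
      have : x + x ^ 2 = x * (1 + x) := by ring
      rw [this]
      field_simp
      linear_combination (-1 : F) * h2
    have := hx.2
    rw [e, traceSign_sq_add_self] at this
    norm_num at this
  refine Finset.card_le_card_of_injOn (fun x => x + s / x + s ^ 2 / x ^ 2) ?_ ?_
  · intro x hx
    simp only [Finset.coe_filter, Finset.mem_univ, true_and, Set.mem_ofPred_eq] at hx ⊢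
    obtain ⟨h0, h1, h3⟩ := good hx
    refine ⟨fun h => ?_, by rw [traceSign_isogeny h0 h1 h3, hx.2]⟩
    have e : (x + s) * (x ^ 2 + s) = 0 := by
      field_simp at h
      linear_combination h + s * x ^ 2 * h2
    rcases mul_eq_zero.1 e with e | e
    · exact h1 e
    · exact h3 e
  · intro x hx y hy h
    simp only [Finset.coe_filter, Finset.mem_univ, true_and, Set.mem_ofPred_eq] at hx hy
    by_contra hxy
    have := traceSign_eq_one_of_isogeny_eq hs (good hx).1 (good hy).1 (good hx).2.1 hxy h
    rw [hx.2] at this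
    norm_num at this

/-- For x ≠ 0 the scaling s = xr makes the argument x/(1+r)², linear in x. For fixed r ≠ 1 the sum
over all x is then a complete sum of a nontrivial character. -/
theorem sum_traceSign_mul_kloostermanSum :
    ∑ s : F, traceSign s * kloostermanSum (s ^ 3 * (s + 1)) = 0 := by
  classical
  have : CharP F 2 := charP_of_injective_algebraMap (algebraMap (ZMod 2) F).injective 2
  have key (s : F) : traceSign s * kloostermanSum (s ^ 3 * (s + 1)) =
      ∑ x : F, if x ≠ s then traceSign (x ^ 3 / (x + s) ^ 2) else 0 := by
    rw [traceSign_mul_kloostermanSum, Finset.sum_filter]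
  simp only [key]
  rw [Finset.sum_comm, ← Finset.add_sum_erase _ _ (Finset.mem_univ (0 : F))]
  have h0 : (∑ s : F, if (0 : F) ≠ s then traceSign ((0 : F) ^ 3 / (0 + s) ^ 2) else 0) =
      ∑ r : F, if r ≠ 1 then (1 : ℤ) else 0 := by
    simp only [ne_eq, OfNat.ofNat_ne_zero, not_false_eq_true, zero_pow, zero_div, traceSign_zero]
    -- The row x = 0 is constant, so shifting its excluded index to r = 1 supplies the missing x = 0
    -- term for each r.
    rw [← Equiv.sum_comp (Equiv.addRight (1 : F)) (fun r : F => if ¬ r = 1 then (1 : ℤ) else 0)]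
    refine Finset.sum_congr rfl fun s _ => ?_
    simp [eq_comm]
  have h1 (x : F) (hx : x ∈ Finset.univ.erase (0 : F)) :
      (∑ s : F, if x ≠ s then traceSign (x ^ 3 / (x + s) ^ 2) else 0) =
        ∑ r : F, if r ≠ 1 then traceSign (x * (1 / (1 + r) ^ 2)) else 0 := by
    have hx0 : x ≠ 0 := Finset.ne_of_mem_erase hx
    rw [← Equiv.sum_comp (Equiv.mulLeft₀ x hx0)
      (fun s : F => if x ≠ s then traceSign (x ^ 3 / (x + s) ^ 2) else 0)]
    refine Finset.sum_congr rfl fun r _ => ?_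
    have e : x ^ 3 / (x + x * r) ^ 2 = x * (1 / (1 + r) ^ 2) := by
      have : x + x * r = x * (1 + r) := by ring
      rw [this, mul_pow]
      field_simp
    rw [Equiv.mulLeft₀_apply, e]
    have : x = x * r ↔ r = 1 := by
      rw [eq_comm, mul_eq_left₀ hx0]
    simp [this]
  rw [h0, Finset.sum_congr rfl h1, Finset.sum_comm, ← Finset.sum_add_distrib]
  refine Finset.sum_eq_zero fun r _ => ?_
  by_cases hr : r = 1
  · simp [hr]
  have hr1 : 1 / (1 + r) ^ 2 ≠ 0 := by
    apply one_div_ne_zero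
    apply pow_ne_zero
    rw [add_comm, ← CharTwo.sub_eq_add, sub_ne_zero]
    exact hr
  simp only [ne_eq, hr, not_false_eq_true, if_true]
  have h3 := Equiv.sum_comp (Equiv.mulRight₀ _ hr1) (traceSign (F := F))
  rw [sum_traceSign, ← Finset.add_sum_erase _ _ (Finset.mem_univ (0 : F))] at h3
  simpa [traceSign_zero] using h3

theorem kloostermanSum_three_isogeny (s : F) :
    kloostermanSum (s * (s + 1) ^ 3) = kloostermanSum (s ^ 3 * (s + 1)) := by
  have : CharP F 2 := charP_of_injective_algebraMap (algebraMap (ZMod 2) F).injective 2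
  have hz : ∑ t : F, traceSign t * kloostermanSum (t * (t + 1) ^ 3) = 0 := by
    rw [← Equiv.sum_comp (Equiv.addRight (1 : F))]
    have e (t : F) : traceSign (t + 1) * kloostermanSum ((t + 1) * (t + 1 + 1) ^ 3) =
        traceSign (1 : F) * (traceSign t * kloostermanSum (t ^ 3 * (t + 1))) := by
      rw [add_assoc t, CharTwo.add_self_eq_zero, add_zero, traceSign_add, mul_comm (t + 1)]
      ring
    simp only [Equiv.coe_addRight, e, ← Finset.mul_sum, sum_traceSign_mul_kloostermanSum, mul_zero]
  have h := (Finset.sum_eq_sum_iff_of_le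
    (fun t _ => traceSign_mul_kloostermanSum_le t)).1
      (hz.trans sum_traceSign_mul_kloostermanSum.symm) s (Finset.mem_univ s)
  refine mul_left_cancel₀ (a := traceSign s) ?_ h
  rcases traceSign_eq_one_or s with h | h <;> simp [h]

end Kloosterman

theorem theorem6 {F : Type*} [Field F] [Fintype F] [Algebra (ZMod 2) F]
    (m : ℕ) (hm : 0 < m) (hF : Fintype.card F = 2 ^ m)
    (b : F) (n : ℚ) (bn : F) (hbn : IsRatPow b n bn) (hne : bn ^ 4 + 1 ≠ 0) :
    kloostermanSum
        ((bn * b + b ^ 2) * (bn * b + bn + b ^ 2 + 1) ^ 3 / (bn ^ 4 + 1)) =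
      kloostermanSum
        ((bn * b + b ^ 2) ^ 3 * (bn * b + bn + b ^ 2 + 1) / (bn ^ 4 + 1)) := by
  have : CharP F 2 := charP_of_injective_algebraMap (algebraMap (ZMod 2) F).injective 2
  have h2 := CharTwo.two_eq_zero (R := F)
  have e4 : bn ^ 4 + 1 = (bn + 1) ^ 4 := by
    linear_combination (-2 * bn ^ 3 - 3 * bn ^ 2 - 2 * bn) * h2
  have hd : bn + 1 ≠ 0 := by
    intro h
    rw [e4, h] at hne
    simp at hne
  rw [e4]
  -- Both arguments have degree four in s and s+1, so the denominators combine to (b^n+1)⁴.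
  have ev : (bn * b + b ^ 2) / (bn + 1) + 1 = (bn * b + bn + b ^ 2 + 1) / (bn + 1) := by
    field_simp
    ring
  have h := kloostermanSum_three_isogeny ((bn * b + b ^ 2) / (bn + 1))
  rw [ev] at h
  convert h using 2 <;> field_simp
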